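/- Let $\sigma>0$ and let $\kappa(x)=\pi^{-1/4}\sigma^{-1/2}\exp(-x^2/(2\sigma^2))$. Let $K$ be the operator $Ku=\kappa*u$ from the finite signed Borel measures on $\mathbb R$ to $L^2(\mathbb R)$, let $e_i=\delta(\cdot-i)$ be the Dirac peak at $i\in\mathbb Z$, and let $d_i=Ke_i/\|Ke_i\|$. Let $u=\sum_{i\in I}\alpha_i e_i$ with real $\alpha_i\ne0$ on a finite non-empty support $I\subset\mathbb Z$, $|I|=N$, and let $\rho\ge1$ be an integer with $|i-j|\ge\rho$ for all distinct $i,j\in I$. Put $$A_N:=2\sum_{j=1}^{\lfloor N/2\rfloor}\exp\Big(-\frac{(j\rho)^2}{4\sigma^2}\Big),\qquad B_N:=\sup_{1\le i<\rho}\ \sum_{j=-\lfloor N/2\rfloor}^{\lfloor N/2\rfloor}\exp\Big(-\frac{(i-j\rho)^2}{4\sigma^2}\Big)\ \text{ if }\rho\ge2,\qquad B_N:=2\sum_{j=1}^{\lfloor N/2\rfloor+1}\exp\Big(-\frac{j^2}{4\sigma^2}\Big)\ \text{ if }\rho=1 .$$ (a) The correlations satisfy $$a:=\sup_{i\in I}\sum_{j\in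 I,\,j\ne i}|\langle d_i,d_j\rangle|\le A_N ,\qquad \sup_{i\notin I}\sum_{j\in I}|\langle d_i,d_j\rangle|\le B_N .$$ (b) Let $v^\varepsilon=Ku+\eta$ with $\eta\in L^2(\mathbb R)$, $\|\eta\|\le\varepsilon$, and let $$r:=\frac{\sup_{i\in\mathbb Z}|\langle\eta,d_i\rangle|}{\min_{i\in I}|\alpha_i|\,\|Ke_i\|}$$ be the noise-to-signal ratio. Orthogonal matching pursuit (OMP) starts with $\hat u^0=0$, $I^0=\emptyset$. In iteration $k+1$ it selects any index $i$ that maximises $|\langle v^\varepsilon-K\hat u^k,d_i\rangle|$ over $i\in\mathbb Z$, puts $I^{k+1}=I^k\cup\{i\}$, and takes as $\hat u^{k+1}$ a minimiser of $\|v^\varepsilon-K\hat u\|$ over $\hat u\in\operatorname{span}\{e_i:i\in I^{k+1}\}$; with tolerance $\varepsilon$ it stops as soon as $\|v^\varepsilon-K\hat u^k\|\le\varepsilon$. If $$A_N+B_N<1-2r ,$$ then the following hold. 1. $a<1$, and the exact recovery condition in the presence of noise $\sup_{i\notin I}\|(DP_I)^\dagger d_i\|_{\ell^1}<1-\frac{2r}{1-a}$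 holds, where $DP_I\beta=\sum_{i\in I}\beta_i d_i$ and $\dagger$ is the pseudoinverse. 2. OMP finds the support exactly: for every $k<N$, after any $k$ iterations of OMP (run irrespective of the stopping rule) a maximising index exists and every maximising index lies in $I\setminus I^k$; hence $N$ iterations can be performed, and $I^N=I$ whatever choices are made. 3. OMP with tolerance $\varepsilon$ has a complete run; every complete run stops after some $n\le N$ iterations with $I^n\subseteq I$, and $I^n=I$ if and only if $n=N$. 4. Every complete run of OMP with tolerance $\varepsilon$ stops after exactly $N$ iterations with $I^N=I$ if $\varepsilon=0$ (noiseless data), and also if $$A_N+B_N<1-\frac{2\varepsilon}{\min_{i\in I}|\alpha_i|\,\|Ke_i\|} .$$ -/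

import Mathlib

open MeasureTheory
open scoped RealInnerProductSpace

noncomputable section

/-! ### Orthogonal matching pursuit for a linear operator and a dictionary indexed by `ℤ` -/

namespace OMP

variable {B H : Type*} [AddCommGroup B] [Module ℝ B] [NormedAddCommGroup H] [InnerProductSpace ℝ H]

/-- The normalised atom `d i = K (e i) / ‖K (e i)‖`. -/
def atom (K : B →ₗ[ℝ] H) (e : ℤ → B) (i : ℤ) : H := ‖K (e i)‖⁻¹ • K (e i)

/-- The source `u = ∑ i, α i • e i` with finitely supported coefficients. -/
def source (e : ℤ → B) (α : ℤ →₀ ℝ) : B := ∑ i ∈ α.support, α i • e i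

/-- `sup_{i ∈ I} ∑_{j ∈ I, j ≠ i} |⟪d i, d j⟫|`. -/
def supportCorrelation (K : B →ₗ[ℝ] H) (e : ℤ → B) (I : Finset ℤ) : ℝ :=
  ⨆ i : {i : ℤ // i ∈ I}, ∑ j ∈ I.erase i, |⟪atom K e i, atom K e j⟫|

/-- `sup_{i ∉ I} ∑_{j ∈ I} |⟪d i, d j⟫|`. -/
def offSupportCorrelation (K : B →ₗ[ℝ] H) (e : ℤ → B) (I : Finset ℤ) : ℝ :=
  ⨆ i : {i : ℤ // i ∉ I}, ∑ j ∈ I, |⟪atom K e i, atom K e j⟫|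

/-- `min_{i ∈ supp α} |α i| * ‖K (e i)‖`. -/
def minAmplitude (K : B →ₗ[ℝ] H) (e : ℤ → B) (α : ℤ →₀ ℝ) : ℝ :=
  ⨅ i : {i : ℤ // i ∈ α.support}, |α i| * ‖K (e i)‖

/-- The noise-to-signal ratio
`sup_{i ∈ ℤ} |⟪η, d i⟫| / min_{i ∈ supp α} |α i| * ‖K (e i)‖`. -/
def noiseToSignal (K : B →ₗ[ℝ] H) (e : ℤ → B) (α : ℤ →₀ ℝ) (η : H) : ℝ :=
  (⨆ i : ℤ, |⟪η, atom K e i⟫|) / minAmplitude K e α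

/-- The synthesis operator restricted to coefficients supported in `I`:
`β ↦ ∑_{i ∈ I} β i • d i`. -/
def synthesis (K : B →ₗ[ℝ] H) (e : ℤ → B) (I : Finset ℤ) :
    EuclideanSpace ℝ {i : ℤ // i ∈ I} →ₗ[ℝ] H :=
  Fintype.linearCombination ℝ (fun i : {i : ℤ // i ∈ I} => atom K e i) ∘ₗ
    (WithLp.linearEquiv 2 ℝ ({i : ℤ // i ∈ I} → ℝ)).toLinearMap

/-- The Moore-Penrose pseudoinverse of a linear map with finite-dimensional domain: project
orthogonally onto the range, then take the preimage orthogonal to the kernel. -/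
def pseudoinverse {E : Type*} [NormedAddCommGroup E] [InnerProductSpace ℝ E]
    [FiniteDimensional ℝ E] (T : E →ₗ[ℝ] H) (w : H) : E :=
  ((T.kerComplementEquivRange (C := (LinearMap.ker T)ᗮ)
    (LinearMap.ker T).isCompl_orthogonal.symm).symm
      ((LinearMap.range T).orthogonalProjectionOnto w) : (LinearMap.ker T)ᗮ)

/-- `sup_{i ∉ I} ‖(D P_I)† d i‖_{ℓ¹}`, the quantity in the exact recovery condition. -/
def recoveryConstant (K : B →ₗ[ℝ] H) (e : ℤ → B) (I : Finset ℤ) : ℝ :=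
  ⨆ i : {i : ℤ // i ∉ I}, ∑ j, |pseudoinverse (synthesis K e I) (atom K e i) j|

/-- The exact recovery condition in the presence of noise, for the noise-to-signal ratio `r`. -/
def NoisyERC (K : B →ₗ[ℝ] H) (e : ℤ → B) (I : Finset ℤ) (r : ℝ) : Prop :=
  supportCorrelation K e I < 1 ∧
    recoveryConstant K e I < 1 - 2 * r * (1 / (1 - supportCorrelation K e I))

/-- The indices selected in the first `n` iterations. -/
def selected (idx : ℕ → ℤ) (n : ℕ) : Finset ℤ := (Finset.range n).image idx

/-- `i` maximises the correlation `|⟪w, d j⟫|` over the whole dictionary. -/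
def IsBestAtom (K : B →ₗ[ℝ] H) (e : ℤ → B) (w : H) (i : ℤ) : Prop :=
  ∀ j : ℤ, |⟪w, atom K e j⟫| ≤ |⟪w, atom K e i⟫|

/-- The first `n` iterations of OMP for the data `v`: `idx k` is the index selected in iteration
`k + 1`, `u k` is the approximation after `k` iterations, and `v - K (u k)` is the residual.
Values of `idx k` for `k ≥ n` and of `u k` for `k > n` are irrelevant. -/
structure IsIteration (K : B →ₗ[ℝ] H) (e : ℤ → B) (v : H) (n : ℕ) (idx : ℕ → ℤ) (u : ℕ → B) :
    Prop where
  init : u 0 = 0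
  select : ∀ k < n, IsBestAtom K e (v - K (u k)) (idx k)
  mem_span : ∀ k < n, u (k + 1) ∈ Submodule.span ℝ (e '' (selected idx (k + 1) : Set ℤ))
  project : ∀ k < n, ∀ w ∈ Submodule.span ℝ (e '' (selected idx (k + 1) : Set ℤ)),
    ‖v - K (u (k + 1))‖ ≤ ‖v - K w‖

/-- A complete run of OMP with tolerance `ε`: it iterates as long as the norm of the residual
exceeds `ε`, and it stops after `n` iterations. -/
structure IsRun (K : B →ₗ[ℝ] H) (e : ℤ → B) (v : H) (ε : ℝ) (n : ℕ) (idx : ℕ → ℤ) (u : ℕ → B) :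
    Prop where
  iteration : IsIteration K e v n idx u
  continues : ∀ k < n, ε < ‖v - K (u k)‖
  stops : ‖v - K (u n)‖ ≤ ε

/-- The selection of atoms is correct: as long as fewer than `|I|` iterations were performed, a best
atom exists and every best atom belongs to a not yet selected index of `I`, so that OMP can perform
`|I|` iterations and has then selected exactly the index set `I`, whatever choices it makes. -/
def SelectsSupport (K : B →ₗ[ℝ] H) (e : ℤ → B) (v : H) (I : Finset ℤ) : Prop :=
  (∀ n < I.card, ∀ idx u, IsIteration K e v n idx u →
    (∃ i, IsBestAtom K e (v - K (u n)) i) ∧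
      ∀ i, IsBestAtom K e (v - K (u n)) i → i ∈ I ∧ i ∉ selected idx n) ∧
  (∃ idx u, IsIteration K e v I.card idx u) ∧
  (∀ idx u, IsIteration K e v I.card idx u → selected idx I.card = I)

/-- OMP with tolerance `ε` has a complete run, and every complete run stops after exactly `|I|`
iterations with `I` as the selected index set. -/
def RecoversSupport (K : B →ₗ[ℝ] H) (e : ℤ → B) (v : H) (ε : ℝ) (I : Finset ℤ) : Prop :=
  (∃ n idx u, IsRun K e v ε n idx u) ∧
  ∀ n idx u, IsRun K e v ε n idx u → n = I.card ∧ selected idx n = I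

end OMP

/-! ### Dirac peaks and convolution with a Gaussian kernel -/

namespace GaussianDeconvolution

/-- The `L²`-normalised Gaussian kernel `π^(-1/4) σ^(-1/2) exp (-x² / (2 σ²))`. -/
def kernel (σ x : ℝ) : ℝ :=
  1 / (Real.pi ^ (1 / 4 : ℝ) * σ ^ (1 / 2 : ℝ)) * Real.exp (-x ^ 2 / (2 * σ ^ 2))

/-- The convolution `(κ ∗ u) x = ∫ κ (x - y) du(y)` of the Gaussian kernel with a finite signed
Borel measure. -/
def conv (σ : ℝ) (u : SignedMeasure ℝ) (x : ℝ) : ℝ := ∫ᵛ y, kernel σ (x - y) ∂<•u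

instance (u : SignedMeasure ℝ) : IsFiniteMeasure u.variation := by
  rw [← SignedMeasure.totalVariation_eq_variation]
  unfold SignedMeasure.totalVariation
  infer_instance

theorem continuous_kernel (σ : ℝ) : Continuous (kernel σ) := by
  unfold kernel
  fun_prop

theorem norm_kernel_le (σ x : ℝ) :
    ‖kernel σ x‖ ≤ ‖1 / (Real.pi ^ (1 / 4 : ℝ) * σ ^ (1 / 2 : ℝ))‖ := by
  unfold kernel
  rw [norm_mul]
  refine mul_le_of_le_one_right (norm_nonneg _) ?_
  rw [Real.norm_eq_abs, Real.abs_exp, Real.exp_le_one_iff, neg_div]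
  exact neg_nonpos.mpr (by positivity)

theorem integrable_kernel {σ : ℝ} (hσ : 0 < σ) : Integrable (kernel σ) := by
  unfold kernel
  refine Integrable.const_mul ?_ _
  have h := integrable_exp_neg_mul_sq (b := 1 / (2 * σ ^ 2)) (by positivity)
  refine h.congr (Filter.Eventually.of_forall fun x => ?_)
  simp only
  congr 1
  ring

theorem integrable_kernel_sub (σ : ℝ) (u : SignedMeasure ℝ) (x : ℝ) :
    Integrable (fun y => kernel σ (x - y)) u.variation :=
  Integrable.of_bound ((continuous_kernel σ).comp (by fun_prop)).aestronglyMeasurable _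
    (Filter.Eventually.of_forall fun _ => norm_kernel_le σ _)

theorem norm_conv_le (σ : ℝ) (u : SignedMeasure ℝ) (x : ℝ) :
    ‖conv σ u x‖ ≤ ∫ y, ‖kernel σ (x - y)‖ ∂u.variation := by
  have h1 : ‖(ContinuousLinearMap.lsmul ℝ ℝ : ℝ →L[ℝ] ℝ →L[ℝ] ℝ).flip‖ ≤ 1 := by
    rw [ContinuousLinearMap.opNorm_flip]
    exact ContinuousLinearMap.opNorm_lsmul_le
  refine VectorMeasure.norm_integral_le_integral_norm.trans ?_
  exact mul_le_of_le_one_left (integral_nonneg fun _ => norm_nonneg _) h1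

theorem continuous_conv (σ : ℝ) (u : SignedMeasure ℝ) : Continuous (conv σ u) :=
  VectorMeasure.continuous_of_dominated
    (fun _ => ((continuous_kernel σ).comp (by fun_prop)).aestronglyMeasurable)
    (fun _ => Filter.Eventually.of_forall fun _ => norm_kernel_le σ _)
    (integrable_const _)
    (Filter.Eventually.of_forall fun _ => (continuous_kernel σ).comp (by fun_prop))

theorem memLp_conv {σ : ℝ} (hσ : 0 < σ) (u : SignedMeasure ℝ) :
    MemLp (conv σ u) 2 volume := by
  set c : ℝ := ‖1 / (Real.pi ^ (1 / 4 : ℝ) * σ ^ (1 / 2 : ℝ))‖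
  have hprod : Integrable (fun p : ℝ × ℝ => kernel σ (p.1 - p.2)) (volume.prod u.variation) := by
    have hc : Continuous (fun p : ℝ × ℝ => kernel σ (p.1 - p.2)) :=
      (continuous_kernel σ).comp (by fun_prop)
    rw [integrable_prod_iff' hc.aestronglyMeasurable]
    refine ⟨Filter.Eventually.of_forall fun y => (integrable_kernel hσ).comp_sub_right y, ?_⟩
    simp only [integral_sub_right_eq_self (fun x => ‖kernel σ x‖)]
    exact integrable_const _
  have hint : Integrable (conv σ u) volume :=
    hprod.norm.integral_prod_left.mono' (continuous_conv σ u).aestronglyMeasurable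
      (Filter.Eventually.of_forall (norm_conv_le σ u))
  have hbound : ∀ x, ‖conv σ u x‖ ≤ u.variation.real Set.univ * c := fun x =>
    (norm_conv_le σ u x).trans <| by
      refine (integral_mono (integrable_kernel_sub σ u x).norm (integrable_const c)
        (fun y => norm_kernel_le σ _)).trans ?_
      simp
  rw [memLp_two_iff_integrable_sq (continuous_conv σ u).aestronglyMeasurable]
  refine (hint.norm.const_mul (u.variation.real Set.univ * c)).mono'
    ((continuous_conv σ u).pow 2).aestronglyMeasurable (Filter.Eventually.of_forall fun x => ?_)
  rw [norm_pow, sq]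
  exact mul_le_mul_of_nonneg_right (hbound x) (norm_nonneg _)

/-- The convolution operator `K u = κ ∗ u` from the finite signed Borel measures on `ℝ`
to `L²(ℝ)`. -/
def convOperator (σ : ℝ) (hσ : 0 < σ) : SignedMeasure ℝ →ₗ[ℝ] Lp ℝ 2 (volume : Measure ℝ) where
  toFun u := (memLp_conv hσ u).toLp (conv σ u)
  map_add' u w := by
    rw [← MemLp.toLp_add]
    congr 1
    funext x
    exact VectorMeasure.integral_add_vectorMeasure
      (integrable_kernel_sub σ u x) (integrable_kernel_sub σ w x)
  map_smul' a u := by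
    rw [RingHom.id_apply, ← MemLp.toLp_const_smul]
    congr 1
    funext x
    exact VectorMeasure.integral_smul_vectorMeasure _ a

/-- The Dirac peak `δ(· - i)` at the integer `i`, as a signed measure. -/
def diracPeak (i : ℤ) : SignedMeasure ℝ := VectorMeasure.dirac (i : ℝ) (1 : ℝ)

/-- `2 ∑_{j=1}^{⌊N/2⌋} exp (-(j ρ)² / (4 σ²))`. -/
def supportSum (σ : ℝ) (ρ N : ℕ) : ℝ :=
  2 * ∑ j ∈ Finset.Icc 1 (N / 2), Real.exp (-((j : ℝ) * ρ) ^ 2 / (4 * σ ^ 2))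

/-- For `ρ ≥ 2`:
`sup_{1 ≤ i < ρ} ∑_{j=-⌊N/2⌋}^{⌊N/2⌋} exp (-(i - j ρ)² / (4 σ²))`;
for `ρ = 1`: `2 ∑_{j=1}^{⌊N/2⌋+1} exp (-j² / (4 σ²))`. -/
def offSupportSum (σ : ℝ) (ρ N : ℕ) : ℝ :=
  if ρ = 1 then
    2 * ∑ j ∈ Finset.Icc 1 (N / 2 + 1), Real.exp (-(j : ℝ) ^ 2 / (4 * σ ^ 2))
  else
    ⨆ i : {i : ℕ // 1 ≤ i ∧ i < ρ}, ∑ j ∈ Finset.Icc (-((N / 2 : ℕ) : ℤ)) ((N / 2 : ℕ) : ℤ),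
      Real.exp (-(((i : ℕ) : ℝ) - (j : ℝ) * ρ) ^ 2 / (4 * σ ^ 2))

end GaussianDeconvolution

end

open OMP GaussianDeconvolution

open OMP GaussianDeconvolution

/-! The correlations of the atoms are Gaussian samples: `⟪d i, d j⟫ = exp (-(i - j)² / (4 σ²))`, an
even function decreasing in `|i - j|` (`inner_atom`). Part (a) is therefore an extremal problem:
which `ρ`-separated set of `N` integers has the largest Gaussian sum? Rounding every point towards
the origin maps such a set injectively into a shifted lattice `ρℤ - t` and only increases the terms
(`exists_injOn_lattice`); a rearrangement argument then replaces the image by the lattice points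
nearest to the origin (`sum_separated_le_of_two_mul_le`).

The rest holds for any linear `K` with `K (e i) ≠ 0`. Let `a` and `b` be the correlation sums on and
off the support. The Gram matrix of the support is diagonally dominant with margin `1 - a`, so its
inverse is bounded by `1 / (1 - a)` in `ℓ¹`, whence the recovery constant is at most `b / (1 - a)`
(`recoveryConstant_le`). For OMP, the residual is a combination of support atoms plus noise; the
atom with the largest coefficient beats every atom off the support when `a + b < 1 - 2r`
(`OMP.exists_correlation_lt`), and selected atoms are orthogonal to the residual. Each of the first
`N` iterations thus adds a new support index. Early stopping is excluded when the best correlation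
provably exceeds `ε`, since it bounds the residual norm from below. -/

namespace GaussianDeconvolution

/-! ### Correlations of Gaussian atoms. -/

theorem conv_diracPeak (σ : ℝ) (i : ℤ) (x : ℝ) : conv σ (diracPeak i) x = kernel σ (x - i) := by
  unfold conv diracPeak
  rw [VectorMeasure.integral_dirac]
  simp

/-- Completing the square: `(x - a)² + (x - b)² = 2 (x - (a + b) / 2)² + (a - b)² / 2`. -/
theorem kernel_mul_kernel {σ : ℝ} (hσ : 0 < σ) (a b x : ℝ) :
    kernel σ (x - a) * kernel σ (x - b) =
      1 / (√Real.pi * σ) * Real.exp (-(a - b) ^ 2 / (4 * σ ^ 2)) *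
        Real.exp (-(1 / σ ^ 2) * (x - (a + b) / 2) ^ 2) := by
  have h1 : (Real.pi ^ (1 / 4 : ℝ) * σ ^ (1 / 2 : ℝ)) * (Real.pi ^ (1 / 4 : ℝ) * σ ^ (1 / 2 : ℝ))
      = √Real.pi * σ := by
    rw [mul_mul_mul_comm, ← Real.rpow_add Real.pi_pos, ← Real.rpow_add hσ, Real.sqrt_eq_rpow]
    norm_num
  unfold kernel
  rw [mul_mul_mul_comm, ← Real.exp_add, div_mul_div_comm, one_mul, h1, mul_assoc, ← Real.exp_add]
  congr 2
  field_simp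
  ring

theorem integral_kernel_mul_kernel {σ : ℝ} (hσ : 0 < σ) (a b : ℝ) :
    ∫ x, kernel σ (x - a) * kernel σ (x - b) = Real.exp (-(a - b) ^ 2 / (4 * σ ^ 2)) := by
  simp_rw [kernel_mul_kernel hσ]
  rw [integral_const_mul,
    integral_sub_right_eq_self (fun x => Real.exp (-(1 / σ ^ 2) * x ^ 2)) ((a + b) / 2),
    integral_gaussian, div_div_eq_mul_div, div_one, Real.sqrt_mul Real.pi_pos.le,
    Real.sqrt_sq hσ.le]
  have : √Real.pi ≠ 0 := by positivity
  field_simp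

theorem inner_convOperator_diracPeak {σ : ℝ} (hσ : 0 < σ) (i j : ℤ) :
    ⟪convOperator σ hσ (diracPeak i), convOperator σ hσ (diracPeak j)⟫ =
      Real.exp (-((i : ℝ) - j) ^ 2 / (4 * σ ^ 2)) := by
  rw [← integral_kernel_mul_kernel hσ, L2.inner_def]
  refine integral_congr_ae ?_
  filter_upwards [(memLp_conv hσ (diracPeak i)).coeFn_toLp,
    (memLp_conv hσ (diracPeak j)).coeFn_toLp] with x hi hj
  rw [conv_diracPeak] at hi hj
  change ⟪((memLp_conv hσ (diracPeak i)).toLp _ : ℝ → ℝ) x,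
    ((memLp_conv hσ (diracPeak j)).toLp _ : ℝ → ℝ) x⟫ = _
  rw [hi, hj, real_inner_eq_re_inner, mul_comm]
  simp

theorem norm_convOperator_diracPeak {σ : ℝ} (hσ : 0 < σ) (i : ℤ) :
    ‖convOperator σ hσ (diracPeak i)‖ = 1 := by
  have h := inner_convOperator_diracPeak hσ i i
  rw [real_inner_self_eq_norm_sq] at h
  refine (sq_eq_sq₀ (norm_nonneg _) zero_le_one).1 ?_
  rw [h]
  simp

theorem inner_atom {σ : ℝ} (hσ : 0 < σ) (i j : ℤ) :
    ⟪atom (convOperator σ hσ) diracPeak i, atom (convOperator σ hσ) diracPeak j⟫ =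
      Real.exp (-((i : ℝ) - j) ^ 2 / (4 * σ ^ 2)) := by
  simp [atom, norm_convOperator_diracPeak, inner_convOperator_diracPeak]

end GaussianDeconvolution

/-! ### Sums of even decreasing functions over separated sets of integers. -/

theorem Finset.sum_le_sum_of_card_le {ι : Type*} [DecidableEq ι] {f : ι → ℝ} {S T : Finset ι}
    (hcard : S.card ≤ T.card) (hf : ∀ i, 0 ≤ f i)
    (hle : ∀ i ∉ T, ∀ j ∈ T, f i ≤ f j) : ∑ i ∈ S, f i ≤ ∑ i ∈ T, f i := by
  have hcard' : (S \ T).card ≤ (T \ S).card := by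
    have h1 := Finset.card_sdiff_add_card_inter S T
    have h2 := Finset.card_sdiff_add_card_inter T S
    rw [Finset.inter_comm] at h2
    omega
  -- The common part cancels, and any injection of `S \ T` into `T \ S` increases every term.
  have key : ∑ i ∈ S \ T, f i ≤ ∑ i ∈ T \ S, f i := by
    obtain ⟨U, hU, hUc⟩ := Finset.exists_subset_card_eq hcard'
    refine le_trans ?_ (Finset.sum_le_sum_of_subset_of_nonneg hU fun i _ _ => hf i)
    let φ := Finset.equivOfCardEq hUc.symm
    rw [← Finset.sum_coe_sort (S \ T), ← Finset.sum_coe_sort U, ← φ.sum_comp]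
    refine Finset.sum_le_sum fun i _ => hle _ ?_ _ ?_
    · exact (Finset.mem_sdiff.1 i.2).2
    · exact (Finset.mem_sdiff.1 (hU (φ i).2)).1
  have h1 := Finset.sum_inter_add_sum_sdiff S T f
  have h2 := Finset.sum_inter_add_sum_sdiff T S f
  rw [Finset.inter_comm] at h2
  linarith

section Separated

variable {g : ℤ → ℝ} {D : Finset ℤ} {ρ t : ℤ}

/-- A separated set with a gap around `0` is at least as spread out as the lattice
`{k ρ - t | k ∈ ℤ}`. -/
theorem exists_injOn_lattice (hρ : 0 < ρ) (h0 : 0 ≤ t) (ht : t ≤ ρ)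
    (hsep : ∀ i ∈ D, ∀ j ∈ D, i ≠ j → ρ ≤ |i - j|)
    (hgap : ∀ d ∈ D, d ≤ -t ∨ ρ - t ≤ d) :
    ∃ φ : ℤ → ℤ, Set.InjOn φ D ∧ ∀ d ∈ D, |t - φ d * ρ| ≤ |d| := by
  -- `k ρ - t` is `d` rounded towards the origin. The points rounded to a given `k` lie in a
  -- half-open cell of length `ρ`, which holds at most one point of `D`. The gap ensures that
  -- rounding does not cross the origin.
  have hex : ∀ d : ℤ, ∃ k : ℤ, d ∈ D →
      (k ≤ 0 ∧ k * ρ - t - ρ < d ∧ d ≤ k * ρ - t) ∨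
        (1 ≤ k ∧ k * ρ - t ≤ d ∧ d < k * ρ - t + ρ) := by
    intro d
    by_cases hd : d ∈ D
    · rcases hgap d hd with h | h
      · refine ⟨-(-(d + t) / ρ), fun _ => Or.inl ?_⟩
        have h1 := Int.ediv_mul_le (-(d + t)) hρ.ne'
        have h2 := Int.lt_ediv_add_one_mul_self (-(d + t)) hρ
        have h3 : 0 ≤ -(d + t) / ρ := Int.ediv_nonneg (by omega) hρ.le
        exact ⟨by omega, by linarith, by linarith⟩
      · refine ⟨(d + t) / ρ, fun _ => Or.inr ?_⟩
        have h1 := Int.ediv_mul_le (d + t) hρ.ne'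
        have h2 := Int.lt_ediv_add_one_mul_self (d + t) hρ
        have h3 : 1 ≤ (d + t) / ρ := (Int.le_ediv_iff_mul_le hρ).2 (by omega)
        exact ⟨h3, by linarith, by linarith⟩
    · exact ⟨0, fun h => absurd h hd⟩
  choose φ hφ using hex
  refine ⟨φ, fun d hd d' hd' h => ?_, fun d hd => ?_⟩
  · by_contra hne
    have hs := hsep d hd d' hd' hne
    have h1 := hφ d hd
    have h2 := hφ d' hd'
    rw [← h] at h2
    have : |d - d'| < ρ := by
      rw [abs_lt]
      rcases h1 with h1 | h1 <;> rcases h2 with h2 | h2 <;> constructor <;> linarith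
    omega
  · rcases hφ d hd with ⟨h1, h2, h3⟩ | ⟨h1, h2, h3⟩
    · have : φ d * ρ ≤ 0 := mul_nonpos_of_nonpos_of_nonneg h1 hρ.le
      rw [abs_of_nonneg (by linarith), abs_of_nonpos (by linarith)]
      linarith
    · have : ρ ≤ φ d * ρ := le_mul_of_one_le_left hρ.le h1
      rw [abs_of_nonpos (by linarith), abs_of_nonneg (by linarith)]
      linarith

theorem sum_separated_le_of_two_mul_le (hg0 : ∀ a, 0 ≤ g a)
    (hg : ∀ a b, |a| ≤ |b| → g b ≤ g a) (hρ : 0 < ρ) (h0 : 0 ≤ t) (ht : 2 * t ≤ ρ)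
    (hsep : ∀ i ∈ D, ∀ j ∈ D, i ≠ j → ρ ≤ |i - j|)
    (hgap : ∀ d ∈ D, d ≤ -t ∨ ρ - t ≤ d) {M : ℕ} (hM : D.card ≤ 2 * M + 1) :
    ∑ d ∈ D, g d ≤ ∑ k ∈ Finset.Icc (-(M : ℤ)) M, g (t - k * ρ) := by
  obtain ⟨φ, hinj, hφ⟩ := exists_injOn_lattice hρ h0 (by omega) hsep hgap
  calc ∑ d ∈ D, g d ≤ ∑ d ∈ D, g (t - φ d * ρ) :=
        Finset.sum_le_sum fun d hd => hg _ _ (hφ d hd)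
    _ = ∑ k ∈ D.image φ, g (t - k * ρ) := (Finset.sum_image (f := fun k => g (t - k * ρ)) hinj).symm
    _ ≤ _ := by
      refine Finset.sum_le_sum_of_card_le (f := fun k => g (t - k * ρ)) ?_ (fun _ => hg0 _) ?_
      · rw [Finset.card_image_of_injOn hinj, Int.card_Icc]
        omega
      · intro i hi j hj
        rw [Finset.mem_Icc] at hi hj
        apply hg
        have hj1 : -(M * ρ) ≤ j * ρ := by nlinarith
        have hj2 : j * ρ ≤ M * ρ := by nlinarith
        -- Lattice points outside the window have modulus at least `(M + 1) ρ - t`; this is at least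
        -- `M ρ + t` exactly because `2 t ≤ ρ`.
        have hjb : |t - j * ρ| ≤ M * ρ + t := abs_le.2 ⟨by linarith, by linarith⟩
        refine hjb.trans ?_
        rcases lt_or_ge i (-(M : ℤ)) with h | h
        · have : i * ρ ≤ -(M * ρ) - ρ := by nlinarith
          exact le_abs.2 (Or.inl (by linarith))
        · have : M * ρ + ρ ≤ i * ρ := by
            have : (M : ℤ) + 1 ≤ i := by omega
            nlinarith
          exact le_abs.2 (Or.inr (by linarith))

theorem sum_Icc_neg_eq (M : ℕ) (f : ℤ → ℝ) (hf : ∀ k, f (-k) = f k) :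
    ∑ k ∈ Finset.Icc (-(M : ℤ)) M, f k = f 0 + 2 * ∑ k ∈ Finset.Icc 1 M, f (k : ℕ) := by
  induction M with
  | zero => simp
  | succ M ih =>
    have h : Finset.Icc (-((M + 1 : ℕ) : ℤ)) ((M + 1 : ℕ) : ℤ) =
        insert (-((M + 1 : ℕ) : ℤ)) (insert ((M + 1 : ℕ) : ℤ) (Finset.Icc (-(M : ℤ)) M)) := by
      ext k
      simp only [Finset.mem_Icc, Finset.mem_insert]
      omega
    rw [h, Finset.sum_insert, Finset.sum_insert, ih, hf, Finset.sum_Icc_succ_top (by omega)]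
    · ring
    · simp
    · simp only [Finset.mem_Icc, Finset.mem_insert]
      omega

/-- A `ρ`-separated set avoiding `0` avoids an open interval of length `ρ` with integer
endpoints around `0`. -/
theorem exists_gap (hρ : 2 ≤ ρ) (hsep : ∀ i ∈ D, ∀ j ∈ D, i ≠ j → ρ ≤ |i - j|) (hD : 0 ∉ D) :
    ∃ t, 1 ≤ t ∧ t < ρ ∧ ∀ d ∈ D, d ≤ -t ∨ ρ - t ≤ d := by
  by_cases h1 : ∃ d ∈ D, -ρ < d ∧ d < ρ
  · obtain ⟨d, hd, hl, hr⟩ := h1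
    have hd0 : d ≠ 0 := fun h => hD (h ▸ hd)
    rcases lt_or_gt_of_ne hd0 with h | h
    -- The point `d` near the origin is one end of the gap; separation from `d` clears the next `ρ`
    -- integers on the side of the origin.
    · refine ⟨-d, by omega, by omega, fun d' hd' => ?_⟩
      by_cases hdd : d' = d
      · left; omega
      · rcases le_abs.1 (hsep d' hd' d hd hdd) with h | h <;> omega
    · refine ⟨ρ - d, by omega, by omega, fun d' hd' => ?_⟩
      by_cases hdd : d' = d
      · right; omega
      · rcases le_abs.1 (hsep d' hd' d hd hdd) with h | h <;> omega
  · push Not at h1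
    refine ⟨1, le_rfl, by omega, fun d hd => ?_⟩
    have := h1 d hd
    omega

theorem exists_sum_separated_le (hg0 : ∀ a, 0 ≤ g a)
    (hg : ∀ a b, |a| ≤ |b| → g b ≤ g a) (hρ : 2 ≤ ρ)
    (hsep : ∀ i ∈ D, ∀ j ∈ D, i ≠ j → ρ ≤ |i - j|) (hD : 0 ∉ D)
    {M : ℕ} (hM : D.card ≤ 2 * M + 1) :
    ∃ t, 1 ≤ t ∧ t < ρ ∧ ∑ d ∈ D, g d ≤ ∑ k ∈ Finset.Icc (-(M : ℤ)) M, g (t - k * ρ) := by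
  obtain ⟨t, h1, h2, hgap⟩ := exists_gap hρ hsep hD
  rcases le_total (2 * t) ρ with ht | ht
  · exact ⟨t, h1, h2, sum_separated_le_of_two_mul_le hg0 hg (by omega) (by omega) ht hsep hgap hM⟩
  -- Reflecting `D` turns the gap `(-t, ρ - t)` into `(-(ρ - t), t)`, so the shift becomes at most
  -- `ρ / 2`.
  · refine ⟨ρ - t, by omega, by omega, ?_⟩
    have hgneg : ∀ a, g (-a) = g a := fun a =>
      le_antisymm (hg _ _ (abs_neg a).ge) (hg _ _ (abs_neg a).le)
    have hinj : Function.Injective (fun d : ℤ => -d) := neg_injective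
    have key := sum_separated_le_of_two_mul_le (D := D.image fun d => -d) (t := ρ - t) (ρ := ρ)
      hg0 hg (by omega) (by omega) (by omega) ?_ ?_
      (by rwa [Finset.card_image_of_injective _ hinj])
    · rw [Finset.sum_image hinj.injOn] at key
      simpa only [hgneg] using key
    · simp only [Finset.mem_image]
      rintro _ ⟨i, hi, rfl⟩ _ ⟨j, hj, rfl⟩ hij
      have := hsep i hi j hj (fun h => hij (by rw [h]))
      rwa [← abs_neg, neg_sub_neg, neg_sub]
    · simp only [Finset.mem_image]
      rintro _ ⟨d, hd, rfl⟩
      have := hgap d hd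
      omega

end Separated

/-! ### Elementary bounds on atoms, correlations and noise. -/

namespace OMP

variable {B H : Type*} [AddCommGroup B] [Module ℝ B] [NormedAddCommGroup H] [InnerProductSpace ℝ H]
  {K : B →ₗ[ℝ] H} {e : ℤ → B}

theorem le_supportCorrelation {I : Finset ℤ} {i : ℤ} (hi : i ∈ I) :
    ∑ j ∈ I.erase i, |⟪atom K e i, atom K e j⟫| ≤ supportCorrelation K e I :=
  le_ciSup (f := fun i : {i : ℤ // i ∈ I} => ∑ j ∈ I.erase i, |⟪atom K e i, atom K e j⟫|)
    (Set.finite_range _).bddAbove ⟨i, hi⟩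

section Basic

variable (hK : ∀ i, K (e i) ≠ 0)
include hK

theorem norm_atom (i : ℤ) : ‖atom K e i‖ = 1 := by
  rw [atom, norm_smul, norm_inv, norm_norm, inv_mul_cancel₀ (norm_ne_zero_iff.2 (hK i))]

theorem map_eq_smul_atom (i : ℤ) : K (e i) = ‖K (e i)‖ • atom K e i := by
  rw [atom, smul_smul, mul_inv_cancel₀ (norm_ne_zero_iff.2 (hK i)), one_smul]

theorem abs_inner_atom_le (w : H) (i : ℤ) : |⟪w, atom K e i⟫| ≤ ‖w‖ := by
  simpa [norm_atom hK] using abs_real_inner_le_norm w (atom K e i)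

theorem inner_atom_self (i : ℤ) : ⟪atom K e i, atom K e i⟫ = 1 := by
  rw [real_inner_self_eq_norm_sq, norm_atom hK, one_pow]

theorem bddAbove_noise (η : H) : BddAbove (Set.range fun i => |⟪η, atom K e i⟫|) :=
  ⟨‖η‖, by rintro _ ⟨i, rfl⟩; exact abs_inner_atom_le hK η i⟩

theorem le_offSupportCorrelation {I : Finset ℤ} {i : ℤ} (hi : i ∉ I) :
    ∑ j ∈ I, |⟪atom K e i, atom K e j⟫| ≤ offSupportCorrelation K e I := by
  refine le_ciSup (f := fun i : {i : ℤ // i ∉ I} => ∑ j ∈ I, |⟪atom K e i, atom K e j⟫|)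
    ⟨∑ j ∈ I, 1, ?_⟩ ⟨i, hi⟩
  rintro _ ⟨i, rfl⟩
  exact Finset.sum_le_sum fun j _ => (abs_inner_atom_le hK _ _).trans (norm_atom hK _).le

end Basic

theorem exists_notMem (I : Finset ℤ) : ∃ i : ℤ, i ∉ I := Infinite.exists_notMem_finset I

theorem offSupportCorrelation_nonneg (I : Finset ℤ) : 0 ≤ offSupportCorrelation K e I :=
  Real.iSup_nonneg fun _ => Finset.sum_nonneg fun _ _ => abs_nonneg _

theorem minAmplitude_le (α : ℤ →₀ ℝ) {i : ℤ} (hi : i ∈ α.support) :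
    minAmplitude K e α ≤ |α i| * ‖K (e i)‖ :=
  ciInf_le (f := fun i : {i : ℤ // i ∈ α.support} => |α i| * ‖K (e i)‖)
    (Set.finite_range _).bddBelow ⟨i, hi⟩

theorem minAmplitude_pos (hK : ∀ i, K (e i) ≠ 0) {α : ℤ →₀ ℝ} (hα : α ≠ 0) :
    0 < minAmplitude K e α := by
  obtain ⟨i, hi⟩ := Finsupp.support_nonempty_iff.2 hα
  have : Nonempty {i : ℤ // i ∈ α.support} := ⟨⟨i, hi⟩⟩
  obtain ⟨j, hj⟩ := exists_eq_ciInf_of_finite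
    (f := fun i : {i : ℤ // i ∈ α.support} => |α i| * ‖K (e i)‖)
  unfold minAmplitude
  rw [← hj]
  exact mul_pos (abs_pos.2 (Finsupp.mem_support_iff.1 j.2)) (norm_pos_iff.2 (hK j))

theorem noiseToSignal_nonneg (hK : ∀ i, K (e i) ≠ 0) {α : ℤ →₀ ℝ} (hα : α ≠ 0) (η : H) :
    0 ≤ noiseToSignal K e α η :=
  div_nonneg (Real.iSup_nonneg fun _ => abs_nonneg _) (minAmplitude_pos hK hα).le

theorem abs_inner_le_noiseToSignal (hK : ∀ i, K (e i) ≠ 0) {α : ℤ →₀ ℝ} (hα : α ≠ 0) (η : H)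
    (i : ℤ) : |⟪η, atom K e i⟫| ≤ noiseToSignal K e α η * minAmplitude K e α := by
  rw [noiseToSignal, div_mul_cancel₀ _ (minAmplitude_pos hK hα).ne']
  exact le_ciSup (bddAbove_noise hK η) i

/-! ### The exact recovery condition. -/

section Recovery

theorem map_pseudoinverse {E : Type*} [NormedAddCommGroup E] [InnerProductSpace ℝ E]
    [FiniteDimensional ℝ E] (T : E →ₗ[ℝ] H) (w : H) :
    T (pseudoinverse T w) = (LinearMap.range T).starProjection w := by
  have h := LinearEquiv.apply_symm_apply (T.kerComplementEquivRange (C := (LinearMap.ker T)ᗮ)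
    (LinearMap.ker T).isCompl_orthogonal.symm) ((LinearMap.range T).orthogonalProjectionOnto w)
  exact congrArg Subtype.val h

theorem synthesis_apply (I : Finset ℤ) (β : EuclideanSpace ℝ {i : ℤ // i ∈ I}) :
    synthesis K e I β = ∑ j, β j • atom K e j := by
  simp [synthesis, Fintype.linearCombination_apply]

/-- Normal equations: `T T†` is the orthogonal projection onto the range of `T`, which contains the
atoms of `I`. -/
theorem inner_synthesis_pseudoinverse (I : Finset ℤ) (w : H) (i : {i : ℤ // i ∈ I}) :
    ⟪synthesis K e I (pseudoinverse (synthesis K e I) w), atom K e i⟫ = ⟪w, atom K e i⟫ := by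
  rw [map_pseudoinverse]
  have hmem : atom K e i ∈ LinearMap.range (synthesis K e I) :=
    ⟨EuclideanSpace.single i 1, by simp [synthesis_apply, ite_smul]⟩
  rw [Submodule.inner_starProjection_left_eq_right,
    Submodule.starProjection_eq_self_iff.2 hmem]

/-- Diagonal dominance: the Gram matrix has unit diagonal, and its off-diagonal part has `ℓ¹`
operator norm (largest column sum) at most `supportCorrelation K e I`. -/
theorem sum_abs_le_of_gram (hK : ∀ i, K (e i) ≠ 0) (I : Finset ℤ)
    (β : EuclideanSpace ℝ {i : ℤ // i ∈ I}) :
    (1 - supportCorrelation K e I) * ∑ j, |β j| ≤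
      ∑ i : {i : ℤ // i ∈ I}, |⟪synthesis K e I β, atom K e i⟫| := by
  have hrow : ∀ j : {i : ℤ // i ∈ I},
      ∑ i ∈ Finset.univ.erase j, |⟪atom K e j, atom K e i⟫| ≤ supportCorrelation K e I := by
    intro j
    refine le_trans (le_of_eq ?_) (le_supportCorrelation j.2)
    have h1 := Finset.add_sum_erase Finset.univ
      (fun i : {i : ℤ // i ∈ I} => |⟪atom K e j, atom K e i⟫|) (Finset.mem_univ j)
    have h2 := Finset.add_sum_erase I (fun i => |⟪atom K e j, atom K e i⟫|) j.2
    have h3 := Finset.sum_coe_sort I (fun i => |⟪atom K e j, atom K e i⟫|)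
    linarith
  have hentry : ∀ i : {i : ℤ // i ∈ I},
      |β i| - ∑ j ∈ Finset.univ.erase i, |β j| * |⟪atom K e j, atom K e i⟫| ≤
        |⟪synthesis K e I β, atom K e i⟫| := by
    intro i
    rw [synthesis_apply, sum_inner, ← Finset.add_sum_erase _ _ (Finset.mem_univ i)]
    simp only [real_inner_smul_left, inner_atom_self hK, mul_one]
    have h := Finset.abs_sum_le_sum_abs
      (fun j : {i : ℤ // i ∈ I} => β j * ⟪atom K e j, atom K e i⟫) (Finset.univ.erase i)
    simp only [abs_mul] at h
    have h' := abs_sub_abs_le_abs_add (β i)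
      (∑ j ∈ Finset.univ.erase i, β j * ⟪atom K e j, atom K e i⟫)
    linarith
  have hswap : ∑ i : {i : ℤ // i ∈ I}, ∑ j ∈ Finset.univ.erase i,
      |β j| * |⟪atom K e j, atom K e i⟫| =
      ∑ j : {i : ℤ // i ∈ I}, |β j| * ∑ i ∈ Finset.univ.erase j, |⟪atom K e j, atom K e i⟫| := by
    simp_rw [Finset.mul_sum]
    refine Finset.sum_comm' fun i j => ?_
    simp [eq_comm]
  have hcol : ∑ j : {i : ℤ // i ∈ I}, |β j| * ∑ i ∈ Finset.univ.erase j,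
      |⟪atom K e j, atom K e i⟫| ≤ ∑ j, |β j| * supportCorrelation K e I :=
    Finset.sum_le_sum fun j _ => mul_le_mul_of_nonneg_left (hrow j) (abs_nonneg _)
  have hsum := Finset.sum_le_sum fun i (_ : i ∈ Finset.univ) => hentry i
  rw [Finset.sum_sub_distrib, hswap] at hsum
  rw [← Finset.sum_mul] at hcol
  linarith

theorem recoveryConstant_le (hK : ∀ i, K (e i) ≠ 0) (I : Finset ℤ)
    (ha : supportCorrelation K e I < 1) :
    recoveryConstant K e I ≤ offSupportCorrelation K e I / (1 - supportCorrelation K e I) := by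
  obtain ⟨i₀, hi₀⟩ := exists_notMem I
  have : Nonempty {i : ℤ // i ∉ I} := ⟨⟨i₀, hi₀⟩⟩
  refine ciSup_le fun i => ?_
  rw [le_div_iff₀' (by linarith)]
  -- The Gram matrix maps the pseudoinverse coefficients to the correlations of `d i` with the
  -- support atoms.
  refine (sum_abs_le_of_gram hK I _).trans ?_
  simp_rw [inner_synthesis_pseudoinverse]
  rw [Finset.sum_coe_sort I (fun j => |⟪atom K e i, atom K e j⟫|)]
  exact le_offSupportCorrelation hK i.2

theorem noisyERC_of_lt (hK : ∀ i, K (e i) ≠ 0) (I : Finset ℤ) {r : ℝ} (hr : 0 ≤ r)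
    (h : supportCorrelation K e I + offSupportCorrelation K e I < 1 - 2 * r) :
    NoisyERC K e I r := by
  have hb := offSupportCorrelation_nonneg (K := K) (e := e) I
  have ha : supportCorrelation K e I < 1 := by linarith
  refine ⟨ha, (recoveryConstant_le hK I ha).trans_lt ?_⟩
  have hpos : 0 < 1 - supportCorrelation K e I := by linarith
  rw [div_lt_iff₀ hpos, sub_mul, mul_assoc, one_div, inv_mul_cancel₀ hpos.ne']
  linarith

end Recovery

/-! ### Atom selection and the iterates of OMP. -/

section Selection

/-- If the coefficients of `w` on the support include one of size at least `m`, then some atom of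
the support is strictly better correlated with `w` than all atoms off the support. -/
theorem exists_correlation_lt (hK : ∀ i, K (e i) ≠ 0) {I : Finset ℤ} {m δ : ℝ} {η : H}
    (hη : ∀ i, |⟪η, atom K e i⟫| ≤ δ)
    (h : 2 * δ < m * (1 - (supportCorrelation K e I + offSupportCorrelation K e I)))
    (hab : supportCorrelation K e I + offSupportCorrelation K e I < 1)
    {c : ℤ → ℝ} {j₁ : ℤ} (hj₁ : j₁ ∈ I) (hm : m ≤ |c j₁|)
    {w : H} (hw : w = ∑ j ∈ I, c j • atom K e j + η) :
    ∃ j₀ ∈ I, (∀ i ∉ I, |⟪w, atom K e i⟫| < |⟪w, atom K e j₀⟫|) ∧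
      m * (1 - supportCorrelation K e I) - δ ≤ |⟪w, atom K e j₀⟫| := by
  -- With `|c j₀|` maximal, the correlation at `j₀` is at least `|c j₀| (1 - a) - δ`, and off the
  -- support it is at most `|c j₀| b + δ`.
  obtain ⟨j₀, hj₀, hmax⟩ := Finset.exists_max_image I (fun j => |c j|) ⟨j₁, hj₁⟩
  have hmj : m ≤ |c j₀| := hm.trans (hmax j₁ hj₁)
  have hb := offSupportCorrelation_nonneg (K := K) (e := e) I
  have hsum : ∀ (J : Finset ℤ) (i : ℤ), J ⊆ I →
      |∑ j ∈ J, c j * ⟪atom K e j, atom K e i⟫| ≤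
        |c j₀| * ∑ j ∈ J, |⟪atom K e i, atom K e j⟫| := by
    intro J i hJ
    refine (Finset.abs_sum_le_sum_abs _ _).trans ?_
    rw [Finset.mul_sum]
    refine Finset.sum_le_sum fun j hj => ?_
    rw [abs_mul, real_inner_comm]
    exact mul_le_mul_of_nonneg_right (hmax j (hJ hj)) (abs_nonneg _)
  have hexp : ∀ i, ⟪w, atom K e i⟫ =
      ∑ j ∈ I, c j * ⟪atom K e j, atom K e i⟫ + ⟪η, atom K e i⟫ := by
    intro i
    simp only [hw, inner_add_left, sum_inner, real_inner_smul_left]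
  have hon : |c j₀| * (1 - supportCorrelation K e I) - δ ≤ |⟪w, atom K e j₀⟫| := by
    rw [hexp, ← Finset.add_sum_erase _ _ hj₀, inner_atom_self hK, mul_one, add_assoc]
    have h1 := hsum (I.erase j₀) j₀ (Finset.erase_subset _ _)
    have h2 := mul_le_mul_of_nonneg_left (le_supportCorrelation (K := K) (e := e) hj₀)
      (abs_nonneg (c j₀))
    have h3 := abs_sub_abs_le_abs_add (c j₀)
      (∑ j ∈ I.erase j₀, c j * ⟪atom K e j, atom K e j₀⟫ + ⟪η, atom K e j₀⟫)
    have h4 := abs_add_le (∑ j ∈ I.erase j₀, c j * ⟪atom K e j, atom K e j₀⟫) ⟪η, atom K e j₀⟫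
    linarith [hη j₀]
  refine ⟨j₀, hj₀, fun i hi => ?_, ?_⟩
  · have h1 := hsum I i subset_rfl
    have h2 := mul_le_mul_of_nonneg_left (le_offSupportCorrelation hK hi) (abs_nonneg (c j₀))
    have h3 := abs_add_le (∑ j ∈ I, c j * ⟪atom K e j, atom K e i⟫) ⟪η, atom K e i⟫
    have h4 := mul_le_mul_of_nonneg_right hmj (sub_nonneg.2 hab.le)
    rw [hexp i]
    linarith [hη i]
  · have := mul_le_mul_of_nonneg_right hmj
      (by linarith : 0 ≤ 1 - supportCorrelation K e I)
    linarith

theorem selected_succ (idx : ℕ → ℤ) (n : ℕ) :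
    selected idx (n + 1) = insert (idx n) (selected idx n) := by
  rw [selected, Finset.range_add_one, Finset.image_insert, selected]

theorem selected_congr {idx idx' : ℕ → ℤ} {n : ℕ} (h : ∀ k < n, idx k = idx' k) :
    selected idx n = selected idx' n :=
  Finset.image_congr fun k hk => h k (by simpa using hk)

/-- Least squares over the span of finitely many elements has a solution. -/
theorem exists_leastSquares (K : B →ₗ[ℝ] H) (e : ℤ → B) (v : H) (J : Finset ℤ) :
    ∃ u ∈ Submodule.span ℝ (e '' (J : Set ℤ)),
      ∀ w ∈ Submodule.span ℝ (e '' (J : Set ℤ)), ‖v - K u‖ ≤ ‖v - K w‖ := by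
  set S := Submodule.span ℝ (e '' (J : Set ℤ))
  have : FiniteDimensional ℝ S :=
    FiniteDimensional.span_of_finite ℝ ((Finset.finite_toSet J).image e)
  obtain ⟨u, hu, hKu⟩ := Submodule.mem_map.1
    ((S.map K).starProjection_apply_mem v)
  refine ⟨u, hu, fun w hw => ?_⟩
  rw [hKu, Submodule.starProjection_minimal]
  exact ciInf_le (f := fun x : S.map K => ‖v - x‖) ⟨0, by rintro _ ⟨x, rfl⟩; exact norm_nonneg _⟩
    ⟨K w, Submodule.mem_map_of_mem hw⟩

theorem inner_eq_zero_of_leastSquares {v : H} {S : Submodule ℝ B} {u : B} (hu : u ∈ S)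
    (hmin : ∀ w ∈ S, ‖v - K u‖ ≤ ‖v - K w‖) {x : B} (hx : x ∈ S) : ⟪v - K u, K x⟫ = 0 := by
  refine ((S.map K).norm_eq_iInf_iff_real_inner_eq_zero (u := v) (v := K u)
    (Submodule.mem_map_of_mem hu)).1 ?_ _ (Submodule.mem_map_of_mem hx)
  refine le_antisymm (le_ciInf ?_) (ciInf_le (f := fun x : S.map K => ‖v - x‖)
    ⟨0, by rintro _ ⟨x, rfl⟩; exact norm_nonneg _⟩ ⟨K u, Submodule.mem_map_of_mem hu⟩)
  rintro ⟨_, w, hw, rfl⟩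
  exact hmin w hw

namespace IsIteration

variable {v : H} {n : ℕ} {idx : ℕ → ℤ} {u : ℕ → B}

theorem mono (h : IsIteration K e v n idx u) {k : ℕ} (hk : k ≤ n) :
    IsIteration K e v k idx u where
  init := h.init
  select j hj := h.select j (hj.trans_le hk)
  mem_span j hj := h.mem_span j (hj.trans_le hk)
  project j hj := h.project j (hj.trans_le hk)

theorem mem (h : IsIteration K e v n idx u) :
    u n ∈ Submodule.span ℝ (e '' (selected idx n : Set ℤ)) := by
  cases n with
  | zero => rw [h.init]; exact zero_mem _
  | succ n => exact h.mem_span n n.lt_succ_self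

theorem minimal (h : IsIteration K e v n idx u) {w : B}
    (hw : w ∈ Submodule.span ℝ (e '' (selected idx n : Set ℤ))) :
    ‖v - K (u n)‖ ≤ ‖v - K w‖ := by
  cases n with
  | zero =>
    have : w = 0 := by simpa [selected] using hw
    rw [h.init, this]
  | succ n => exact h.project n n.lt_succ_self w hw

/-- Optimality in the least squares problem; this is what prevents an index from being selected
twice. -/
theorem inner_residual (h : IsIteration K e v n idx u) {i : ℤ} (hi : i ∈ selected idx n) :
    ⟪v - K (u n), atom K e i⟫ = 0 := by
  rw [atom, real_inner_smul_right, inner_eq_zero_of_leastSquares h.mem (fun w hw => h.minimal hw)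
    (Submodule.subset_span (Set.mem_image_of_mem e hi)), mul_zero]

theorem zero (K : B →ₗ[ℝ] H) (e : ℤ → B) (v : H) :
    IsIteration K e v 0 (fun _ => 0) (fun _ => 0) where
  init := rfl
  select _ hk := absurd hk (Nat.not_lt_zero _)
  mem_span _ hk := absurd hk (Nat.not_lt_zero _)
  project _ hk := absurd hk (Nat.not_lt_zero _)

theorem exists_succ (h : IsIteration K e v n idx u) (hi : ∃ i, IsBestAtom K e (v - K (u n)) i) :
    ∃ idx' u', IsIteration K e v (n + 1) idx' u' := by
  obtain ⟨i, hi⟩ := hi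
  have hidx : ∀ k < n, Function.update idx n i k = idx k := fun k hk =>
    Function.update_of_ne hk.ne _ _
  have hsel : ∀ k ≤ n, selected (Function.update idx n i) k = selected idx k := fun k hk =>
    selected_congr fun l hl => hidx l (hl.trans_le hk)
  obtain ⟨w, hw, hmin⟩ := exists_leastSquares K e v (selected (Function.update idx n i) (n + 1))
  have hu : ∀ k ≤ n, Function.update u (n + 1) w k = u k := fun k hk =>
    Function.update_of_ne (by omega) _ _
  refine ⟨Function.update idx n i, Function.update u (n + 1) w, ?_, ?_, ?_, ?_⟩
  · rw [hu 0 n.zero_le, h.init]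
  · intro k hk
    rcases Nat.lt_succ_iff_lt_or_eq.1 hk with hk | rfl
    · rw [hidx k hk, hu k hk.le]
      exact h.select k hk
    · rw [hu k le_rfl, Function.update_self]
      exact hi
  · intro k hk
    rcases Nat.lt_succ_iff_lt_or_eq.1 hk with hk | rfl
    · rw [hsel (k + 1) hk, hu (k + 1) hk]
      exact h.mem_span k hk
    · rw [Function.update_self]
      exact hw
  · intro k hk
    rcases Nat.lt_succ_iff_lt_or_eq.1 hk with hk | rfl
    · rw [hsel (k + 1) hk, hu (k + 1) hk]
      exact h.project k hk
    · rw [Function.update_self]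
      exact hmin

/-- Before the support is exhausted, the residual is strictly better correlated with an atom of
the support than with all atoms off the support. -/
theorem exists_correlation_lt (hK : ∀ i, K (e i) ≠ 0) {α : ℤ →₀ ℝ} (hα : α ≠ 0)
    {δ : ℝ} {η : H} (hη : ∀ i, |⟪η, atom K e i⟫| ≤ δ)
    (hab : supportCorrelation K e α.support + offSupportCorrelation K e α.support <
      1 - 2 * (δ / minAmplitude K e α))
    (hv : v = K (source e α) + η) (h : IsIteration K e v n idx u)
    (hsub : selected idx n ⊆ α.support) (hcard : (selected idx n).card < α.support.card) :
    ∃ j₀ ∈ α.support,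
      (∀ i ∉ α.support, |⟪v - K (u n), atom K e i⟫| < |⟪v - K (u n), atom K e j₀⟫|) ∧
      δ < |⟪v - K (u n), atom K e j₀⟫| := by
  have hm := minAmplitude_pos hK hα
  have hδ : 0 ≤ δ := (abs_nonneg _).trans (hη 0)
  have hq : 0 ≤ δ / minAmplitude K e α := div_nonneg hδ hm.le
  have hmain : 2 * δ < minAmplitude K e α *
      (1 - (supportCorrelation K e α.support + offSupportCorrelation K e α.support)) := by
    have : minAmplitude K e α * (2 * (δ / minAmplitude K e α)) = 2 * δ := by
      field_simp
    rw [← this]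
    exact mul_lt_mul_of_pos_left (by linarith) hm
  obtain ⟨c, hc⟩ := (Submodule.mem_span_image_finset_iff_exists_fun' ℝ).1 h.mem
  -- A support index not yet selected keeps its full coefficient `α j₁` in the residual, of size at
  -- least `minAmplitude K e α`.
  obtain ⟨j₁, hj₁, hj₁'⟩ := Finset.exists_mem_notMem_of_card_lt_card hcard
  classical
  let c' : ℤ → ℝ := fun j => (α j - if j ∈ selected idx n then c j else 0) * ‖K (e j)‖
  have hw : v - K (u n) = ∑ j ∈ α.support, c' j • atom K e j + η := by
    have hu : u n = ∑ j ∈ α.support, (if j ∈ selected idx n then c j else 0) • e j := by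
      rw [← hc, ← Finset.sum_subset hsub]
      · exact Finset.sum_congr rfl fun j hj => by rw [if_pos hj]
      · intro j _ hj
        rw [if_neg hj, zero_smul]
    rw [hv, source, add_sub_right_comm, ← map_sub, hu, ← Finset.sum_sub_distrib, map_sum]
    congr 1
    refine Finset.sum_congr rfl fun j _ => ?_
    rw [← sub_smul, map_smul, mul_smul, ← map_eq_smul_atom hK]
  obtain ⟨j₀, hj₀, h1, h2⟩ := OMP.exists_correlation_lt hK hη hmain (by linarith) hj₁
    (by simpa [c', hj₁', abs_mul] using minAmplitude_le α hj₁) hw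
  refine ⟨j₀, hj₀, h1, lt_of_lt_of_le ?_ h2⟩
  -- Dropping `b ≥ 0` from `hmain` gives `m (1 - a) > 2 δ`, where `m` is the minimal amplitude.
  have := mul_nonneg hm.le (offSupportCorrelation_nonneg (K := K) (e := e) α.support)
  linarith

end IsIteration

/-! ### Exact support recovery and stopping of OMP. -/

section Exact

variable {v : H} {α : ℤ →₀ ℝ} {δ : ℝ} {η : H}
  (hK : ∀ i, K (e i) ≠ 0) (hα : α ≠ 0) (hη : ∀ i, |⟪η, atom K e i⟫| ≤ δ)
  (hab : supportCorrelation K e α.support + offSupportCorrelation K e α.support <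
    1 - 2 * (δ / minAmplitude K e α))
  (hv : v = K (source e α) + η)
include hK hα hη hab hv

theorem IsIteration.best_of_selected {n : ℕ} {idx : ℕ → ℤ} {u : ℕ → B}
    (h : IsIteration K e v n idx u)
    (hsub : selected idx n ⊆ α.support) (hcard : (selected idx n).card < α.support.card) :
    (∃ i, IsBestAtom K e (v - K (u n)) i) ∧
      ∀ i, IsBestAtom K e (v - K (u n)) i → i ∈ α.support ∧ i ∉ selected idx n := by
  obtain ⟨j₀, hj₀, hlt, hδ⟩ := h.exists_correlation_lt hK hα hη hab hv hsub hcard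
  constructor
  · obtain ⟨j, hj, hmax⟩ := Finset.exists_max_image α.support
      (fun j => |⟪v - K (u n), atom K e j⟫|) ⟨j₀, hj₀⟩
    refine ⟨j, fun i => ?_⟩
    by_cases hi : i ∈ α.support
    · exact hmax i hi
    · exact (hlt i hi).le.trans (hmax j₀ hj₀)
  · intro i hi
    constructor
    · by_contra hi'
      exact absurd (hi j₀) (not_le.2 (hlt i hi'))
    · intro hi'
      have h0 := hi j₀
      rw [h.inner_residual hi', abs_zero] at h0
      linarith [(abs_nonneg _).trans (hη 0)]

theorem IsIteration.selected_subset {n : ℕ} {idx : ℕ → ℤ} {u : ℕ → B}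
    (h : IsIteration K e v n idx u) (hn : n ≤ α.support.card) :
    selected idx n ⊆ α.support ∧ (selected idx n).card = n := by
  induction n with
  | zero => simp [selected]
  | succ n ih =>
    obtain ⟨hs, hc⟩ := ih (h.mono n.le_succ) (by omega)
    obtain ⟨h1, h2⟩ := ((h.mono n.le_succ).best_of_selected hK hα hη hab hv hs (by omega)).2 _
      (h.select n n.lt_succ_self)
    rw [selected_succ]
    exact ⟨Finset.insert_subset h1 hs, by rw [Finset.card_insert_of_notMem h2, hc]⟩

theorem IsIteration.selected_eq {idx : ℕ → ℤ} {u : ℕ → B}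
    (h : IsIteration K e v α.support.card idx u) : selected idx α.support.card = α.support := by
  obtain ⟨h1, h2⟩ := h.selected_subset hK hα hη hab hv le_rfl
  exact Finset.eq_of_subset_of_card_le h1 h2.ge

theorem exists_isIteration {n : ℕ} (hn : n ≤ α.support.card) :
    ∃ idx u, IsIteration K e v n idx u := by
  induction n with
  | zero => exact ⟨_, _, IsIteration.zero K e v⟩
  | succ n ih =>
    obtain ⟨idx, u, h⟩ := ih (by omega)
    obtain ⟨hs, hc⟩ := h.selected_subset hK hα hη hab hv (by omega)
    exact h.exists_succ (h.best_of_selected hK hα hη hab hv hs (by omega)).1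

theorem selectsSupport : SelectsSupport K e v α.support := by
  refine ⟨fun n hn idx u h => ?_, exists_isIteration hK hα hη hab hv le_rfl,
    fun idx u h => h.selected_eq hK hα hη hab hv⟩
  obtain ⟨hs, hc⟩ := h.selected_subset hK hα hη hab hv hn.le
  exact h.best_of_selected hK hα hη hab hv hs (by omega)

/-- Once the whole support is selected, the true source competes in the least squares problem, with
residual `η`. -/
theorem IsIteration.norm_residual_le {idx : ℕ → ℤ} {u : ℕ → B}
    (h : IsIteration K e v α.support.card idx u) : ‖v - K (u α.support.card)‖ ≤ ‖η‖ := by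
  have hmem : source e α ∈
      Submodule.span ℝ (e '' (selected idx α.support.card : Set ℤ)) := by
    rw [h.selected_eq hK hα hη hab hv]
    exact Submodule.sum_mem _ fun i hi =>
      Submodule.smul_mem _ _ (Submodule.subset_span (Set.mem_image_of_mem e hi))
  have := h.minimal hmem
  rwa [hv, add_sub_cancel_left, ← hv] at this

theorem exists_isRun {ε : ℝ} (hε : ‖η‖ ≤ ε) : ∃ n idx u, IsRun K e v ε n idx u := by
  obtain ⟨idx, u, h⟩ := exists_isIteration hK hα hη hab hv le_rfl
  classical
  -- A complete run is the `N`-step iteration truncated at the first residual within tolerance.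
  have hex : ∃ n, ‖v - K (u n)‖ ≤ ε := ⟨_, (h.norm_residual_le hK hα hη hab hv).trans hε⟩
  have hle : Nat.find hex ≤ α.support.card :=
    Nat.find_min' hex ((h.norm_residual_le hK hα hη hab hv).trans hε)
  exact ⟨Nat.find hex, idx, u, h.mono hle, fun k hk => not_le.1 (Nat.find_min hex hk),
    Nat.find_spec hex⟩

theorem IsRun.le_card {ε : ℝ} (hε : ‖η‖ ≤ ε) {n : ℕ} {idx : ℕ → ℤ} {u : ℕ → B}
    (h : IsRun K e v ε n idx u) : n ≤ α.support.card := by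
  by_contra hn
  have h1 := h.continues _ (not_le.1 hn)
  have h2 := (h.iteration.mono (not_le.1 hn).le).norm_residual_le hK hα hη hab hv
  linarith

theorem IsRun.selected_spec {ε : ℝ} (hε : ‖η‖ ≤ ε) {n : ℕ} {idx : ℕ → ℤ} {u : ℕ → B}
    (h : IsRun K e v ε n idx u) :
    n ≤ α.support.card ∧ selected idx n ⊆ α.support ∧
      (n = α.support.card ↔ selected idx n = α.support) := by
  have hn := h.le_card hK hα hη hab hv hε
  obtain ⟨hs, hc⟩ := h.iteration.selected_subset hK hα hη hab hv hn
  refine ⟨hn, hs, fun hn' => Finset.eq_of_subset_of_card_le hs (by omega), fun heq => ?_⟩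
  rw [← heq, hc]

theorem recoversSupport (hηδ : ‖η‖ ≤ δ) : RecoversSupport K e v δ α.support := by
  refine ⟨exists_isRun hK hα hη hab hv hηδ, fun n idx u h => ?_⟩
  obtain ⟨hn, hs, hiff⟩ := h.selected_spec hK hα hη hab hv hηδ
  suffices n = α.support.card from ⟨this, hiff.1 this⟩
  by_contra hne
  have hlt : (selected idx n).card < α.support.card := by
    rw [(h.iteration.selected_subset hK hα hη hab hv hn).2]
    omega
  -- Before iteration `N` some unit atom has correlation above `δ` with the residual, so the
  -- residual norm exceeds the tolerance `δ`.
  obtain ⟨j₀, -, -, hδ⟩ := h.iteration.exists_correlation_lt hK hα hη hab hv hs hlt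
  linarith [h.stops, abs_inner_atom_le hK (v - K (u n)) j₀]

end Exact

end Selection

end OMP

/-! ### Correlation sums of the Gaussian dictionary. -/

namespace GaussianDeconvolution

section Correlation

variable {σ : ℝ} (hσ : 0 < σ) {ρ : ℕ} {I : Finset ℤ}

theorem gaussian_le_of_abs_le (σ : ℝ) (a b : ℤ) (h : |a| ≤ |b|) :
    Real.exp (-(b : ℝ) ^ 2 / (4 * σ ^ 2)) ≤ Real.exp (-(a : ℝ) ^ 2 / (4 * σ ^ 2)) := by
  rw [Real.exp_le_exp]
  have : (a : ℝ) ^ 2 ≤ (b : ℝ) ^ 2 := sq_le_sq.2 (by exact_mod_cast h)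
  gcongr

theorem abs_inner_atom_eq (i j : ℤ) :
    |⟪atom (convOperator σ hσ) diracPeak i, atom (convOperator σ hσ) diracPeak j⟫| =
      Real.exp (-((j - i : ℤ) : ℝ) ^ 2 / (4 * σ ^ 2)) := by
  rw [inner_atom, Real.abs_exp]
  push_cast
  rw [← neg_sub (j : ℝ) i, neg_sq]

theorem sum_translate (J : Finset ℤ) (i : ℤ) (g : ℤ → ℝ) :
    ∑ j ∈ J, g (j - i) = ∑ d ∈ J.image (· - i), g d :=
  (Finset.sum_image (sub_left_injective.injOn)).symm

theorem separated_translate (hsep : ∀ i ∈ I, ∀ j ∈ I, i ≠ j → (ρ : ℤ) ≤ |i - j|) (i : ℤ) :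
    ∀ d ∈ I.image (· - i), ∀ d' ∈ I.image (· - i), d ≠ d' → (ρ : ℤ) ≤ |d - d'| := by
  simp only [Finset.mem_image]
  rintro _ ⟨a, ha, rfl⟩ _ ⟨b, hb, rfl⟩ hab
  rw [sub_sub_sub_cancel_right]
  exact hsep a ha b hb fun h => hab (by rw [h])

theorem card_translate (i : ℤ) : (I.image (· - i)).card = I.card :=
  Finset.card_image_of_injective _ sub_left_injective

/-- The Gaussian sum over a `ρ`-separated set containing `0`. -/
theorem sum_gaussian_le (hρ : 1 ≤ ρ) {D : Finset ℤ}
    (hsep : ∀ i ∈ D, ∀ j ∈ D, i ≠ j → (ρ : ℤ) ≤ |i - j|) (h0 : 0 ∈ D) {M : ℕ}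
    (hM : D.card ≤ 2 * M + 1) :
    ∑ d ∈ D, Real.exp (-(d : ℝ) ^ 2 / (4 * σ ^ 2)) ≤
      1 + 2 * ∑ j ∈ Finset.Icc 1 M, Real.exp (-((j : ℝ) * ρ) ^ 2 / (4 * σ ^ 2)) := by
  have h := sum_separated_le_of_two_mul_le (t := 0)
    (g := fun d : ℤ => Real.exp (-(d : ℝ) ^ 2 / (4 * σ ^ 2)))
    (fun _ => (Real.exp_pos _).le) (gaussian_le_of_abs_le σ) (by omega : (0 : ℤ) < ρ) le_rfl
    (by omega) hsep (fun d hd => ?_) hM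
  · rw [sum_Icc_neg_eq _ _ fun k => by simp] at h
    simpa using h
  · by_cases hd0 : d = 0
    · left; omega
    · have := hsep d hd 0 h0 hd0
      rw [sub_zero] at this
      rcases le_abs.1 this with h | h <;> omega

theorem supportCorrelation_le (hρ : 1 ≤ ρ) (hI : I.Nonempty)
    (hsep : ∀ i ∈ I, ∀ j ∈ I, i ≠ j → (ρ : ℤ) ≤ |i - j|) :
    supportCorrelation (convOperator σ hσ) diracPeak I ≤ supportSum σ ρ I.card := by
  have : Nonempty {i : ℤ // i ∈ I} := hI.to_subtype
  refine ciSup_le fun i => ?_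
  simp_rw [abs_inner_atom_eq]
  have h1 := Finset.add_sum_erase I
    (fun j : ℤ => Real.exp (-((j - i : ℤ) : ℝ) ^ 2 / (4 * σ ^ 2))) i.2
  rw [sum_translate I i (fun d => Real.exp (-(d : ℝ) ^ 2 / (4 * σ ^ 2)))] at h1
  -- After translating `i` to the origin, its own term `1` cancels; `N ≤ 2 ⌊N/2⌋ + 1` covers both
  -- parities.
  have h2 := sum_gaussian_le (σ := σ) hρ (separated_translate hsep i)
    (Finset.mem_image.2 ⟨i, i.2, sub_self _⟩) (M := I.card / 2)
    (by rw [card_translate]; omega)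
  simp only [sub_self, Int.cast_zero, ne_eq, OfNat.ofNat_ne_zero, not_false_eq_true, zero_pow,
    neg_zero, zero_div, Real.exp_zero] at h1
  unfold supportSum
  linarith

theorem offSupportCorrelation_le (hρ : 1 ≤ ρ)
    (hsep : ∀ i ∈ I, ∀ j ∈ I, i ≠ j → (ρ : ℤ) ≤ |i - j|) :
    offSupportCorrelation (convOperator σ hσ) diracPeak I ≤ offSupportSum σ ρ I.card := by
  obtain ⟨i₀, hi₀⟩ := exists_notMem I
  have : Nonempty {i : ℤ // i ∉ I} := ⟨⟨i₀, hi₀⟩⟩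
  refine ciSup_le fun i => ?_
  simp_rw [abs_inner_atom_eq]
  rw [sum_translate I i (fun d => Real.exp (-(d : ℝ) ^ 2 / (4 * σ ^ 2)))]
  have h0 : (0 : ℤ) ∉ I.image (· - (i : ℤ)) := by
    rw [Finset.mem_image]
    rintro ⟨j, hj, hji⟩
    exact i.2 (sub_eq_zero.1 hji ▸ hj)
  unfold offSupportSum
  split_ifs with h1
  -- For `ρ = 1` adjoining the origin preserves separation. The set then has `N + 1` points, which
  -- for odd `N` requires the window `⌊N/2⌋ + 1`.
  · have h := sum_gaussian_le (σ := σ) le_rfl (D := insert 0 (I.image (· - (i : ℤ))))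
      (fun a _ b _ hab => by
        rw [Nat.cast_one]
        exact Int.one_le_abs (sub_ne_zero.2 hab)) (Finset.mem_insert_self _ _)
      (M := I.card / 2 + 1)
      (by rw [Finset.card_insert_of_notMem h0, card_translate]; omega)
    rw [Finset.sum_insert h0] at h
    simp only [Int.cast_zero, ne_eq, OfNat.ofNat_ne_zero, not_false_eq_true, zero_pow, neg_zero,
      zero_div, Real.exp_zero, Nat.cast_one, mul_one] at h
    linarith
  · obtain ⟨t, ht1, ht2, ht⟩ := exists_sum_separated_le
      (g := fun d : ℤ => Real.exp (-(d : ℝ) ^ 2 / (4 * σ ^ 2)))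
      (fun _ => (Real.exp_pos _).le) (gaussian_le_of_abs_le σ) (by omega : (2 : ℤ) ≤ ρ)
      (separated_translate hsep i) h0 (M := I.card / 2) (by rw [card_translate]; omega)
    refine ht.trans ?_
    lift t to ℕ using by omega
    have : Finite {i : ℕ // 1 ≤ i ∧ i < ρ} :=
      ((Set.finite_lt_nat ρ).subset fun i hi => hi.2).to_subtype
    refine le_trans (le_of_eq ?_) (le_ciSup (f := fun i : {i : ℕ // 1 ≤ i ∧ i < ρ} =>
      ∑ j ∈ Finset.Icc (-((I.card / 2 : ℕ) : ℤ)) ((I.card / 2 : ℕ) : ℤ),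
        Real.exp (-(((i : ℕ) : ℝ) - (j : ℝ) * ρ) ^ 2 / (4 * σ ^ 2)))
      (Set.finite_range _).bddAbove ⟨t, by omega, by omega⟩)
    refine Finset.sum_congr rfl fun k _ => ?_
    push_cast
    rfl

end Correlation

end GaussianDeconvolution

/-! ### The main theorem. -/

theorem mainTheorem5
    (σ : ℝ) (hσ : 0 < σ)
    (α : ℤ →₀ ℝ) (hα : α ≠ 0)
    (ρ : ℕ) (hρ : 1 ≤ ρ)
    (hsep : ∀ i ∈ α.support, ∀ j ∈ α.support, i ≠ j → (ρ : ℤ) ≤ |i - j|) :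
    (supportCorrelation (convOperator σ hσ) diracPeak α.support
        ≤ supportSum σ ρ α.support.card ∧
      offSupportCorrelation (convOperator σ hσ) diracPeak α.support
        ≤ offSupportSum σ ρ α.support.card) ∧
    ∀ (η v : Lp ℝ 2 (volume : Measure ℝ)) (ε : ℝ), ‖η‖ ≤ ε →
      v = convOperator σ hσ (source diracPeak α) + η →
      supportSum σ ρ α.support.card + offSupportSum σ ρ α.support.card
        < 1 - 2 * noiseToSignal (convOperator σ hσ) diracPeak α η →
      NoisyERC (convOperator σ hσ) diracPeak α.support
        (noiseToSignal (convOperator σ hσ) diracPeak α η) ∧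
      SelectsSupport (convOperator σ hσ) diracPeak v α.support ∧
      -- the algorithm with tolerance `ε` terminates within `N` iterations, it never selects an
      -- index outside the support, and it is exact unless it stops before iteration `N`
      (∃ n idx u, IsRun (convOperator σ hσ) diracPeak v ε n idx u) ∧
      (∀ n idx u, IsRun (convOperator σ hσ) diracPeak v ε n idx u →
        n ≤ α.support.card ∧ selected idx n ⊆ α.support ∧
        (n = α.support.card ↔ selected idx n = α.support)) ∧
      -- for noiseless data it is exact
      (ε = 0 → RecoversSupport (convOperator σ hσ) diracPeak v ε α.support) ∧
      -- and so it is if the condition holds with the noise level `ε` bounding the correlations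
      (supportSum σ ρ α.support.card + offSupportSum σ ρ α.support.card
          < 1 - 2 * (ε / minAmplitude (convOperator σ hσ) diracPeak α) →
        RecoversSupport (convOperator σ hσ) diracPeak v ε α.support) := by
  have hI : α.support.Nonempty := Finsupp.support_nonempty_iff.2 hα
  have hK : ∀ i, convOperator σ hσ (diracPeak i) ≠ 0 := fun i =>
    norm_ne_zero_iff.1 (by rw [norm_convOperator_diracPeak]; exact one_ne_zero)
  have hA := supportCorrelation_le hσ hρ hI hsep
  have hB := offSupportCorrelation_le hσ hρ hsep
  refine ⟨⟨hA, hB⟩, fun η v ε hε hv hAB => ?_⟩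
  have hm := minAmplitude_pos hK hα
  have hr := noiseToSignal_nonneg hK hα η
  have hη := abs_inner_le_noiseToSignal hK hα η
  -- Here the noise bound `δ` is `r` times the minimal amplitude, i.e. the supremum of the noise
  -- correlations; `hrec` uses `δ = ε` instead.
  have hab : supportCorrelation (convOperator σ hσ) diracPeak α.support +
      offSupportCorrelation (convOperator σ hσ) diracPeak α.support <
        1 - 2 * (noiseToSignal (convOperator σ hσ) diracPeak α η *
          minAmplitude (convOperator σ hσ) diracPeak α /
            minAmplitude (convOperator σ hσ) diracPeak α) := by
    rw [mul_div_cancel_right₀ _ hm.ne']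
    linarith
  have hrec : supportSum σ ρ α.support.card + offSupportSum σ ρ α.support.card
      < 1 - 2 * (ε / minAmplitude (convOperator σ hσ) diracPeak α) →
      RecoversSupport (convOperator σ hσ) diracPeak v ε α.support := fun h =>
    recoversSupport hK hα (fun i => (abs_inner_atom_le hK η i).trans hε) (by linarith) hv hε
  refine ⟨noisyERC_of_lt hK _ hr (by linarith), selectsSupport hK hα hη hab hv,
    exists_isRun hK hα hη hab hv hε, fun n idx u h => h.selected_spec hK hα hη hab hv hε,
    fun h0 => hrec ?_, hrec⟩
  -- For `ε = 0` the condition becomes `A_N + B_N < 1`, which follows from `r ≥ 0`.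
  rw [h0, zero_div]
  linarith
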